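/- Let $\mathbb K$ be a field of characteristic zero, $\Gamma$ a finitely generated abelian group and $\lambda:\Gamma\times\Gamma\to\mathbb K^\times$ a commutation factor, i.e. $\lambda$ is biadditive and $\lambda(x,y)\lambda(y,x)=1$ for all $x,y\in\Gamma$. Assume that $(\Gamma,\lambda)$ is purely even, i.e. $\lambda(x,x)=1$ for all $x\in\Gamma$. A $(\Gamma,\lambda)$-commutative algebra is an associative unital $\Gamma$-graded $\mathbb K$-algebra $\mathcal A=\bigoplus_{\gamma}\mathcal A^\gamma$ such that $ab=\lambda(x,y)\,ba$ for all $a\in\mathcal A^x$, $b\in\mathcal A^y$; with the degree-preserving morphisms of unital $\mathbb K$-algebras, these algebras form the category $(\Gamma,\lambda)\text{-}\mathtt{Alg}$. Let $n\ge 1$ and $\boldsymbol\nu=(\nu_1,\dots,\nu_n)\in\Gamma^n$. Let $\mathrm{Mat}^0(\boldsymbol\nu;\mathcal A)$ be the algebra of the $n\times n$ matrices $X$ with entries $X^i_{\;j}\in\mathcal A^{-\nu_i+\nu_j}$, and $\mathrm{GL}^0(\boldsymbol\nu;\mathcal A)$ the group of its invertible elements; let $(\mathcal A^0)^\times$ be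 the group of invertible elements of $\mathcal A^0$. Both are functors of $\mathcal A$ from $(\Gamma,\lambda)\text{-}\mathtt{Alg}$ to the category of groups. There exists a unique family of maps $\mathrm{Gdet}^0_{\mathcal A}:\mathrm{GL}^0(\boldsymbol\nu;\mathcal A)\to(\mathcal A^0)^\times$, parameterized by the objects $\mathcal A$ of $(\Gamma,\lambda)\text{-}\mathtt{Alg}$, such that (i) it is a natural transformation of group-valued functors from $\mathrm{GL}^0(\boldsymbol\nu;-)$ to $((-)^0)^\times$; (ii) $\mathrm{Gdet}^0_{\mathcal A}(\mathrm{diag}(1,\dots,1,a))=a$ for every $\mathcal A$ and every invertible $a\in\mathcal A^0$. Moreover, $\mathrm{Gdet}^0_{\mathcal A}(X)=\det_{\underline{\mathcal A}}(J_\varsigma(X))$ for every NS-multiplier $\varsigma$, every $\mathcal A$ and every $X\in\mathrm{GL}^0(\boldsymbol\nu;\mathcal A)$. Here an NS-multiplier (in the purely even case) is a map $\varsigma:\Gamma\times\Gamma\to\mathbb K^\times$ with $\varsigma(0,0)=1$, $\varsigma(x,y+z)\varsigma(y,z)=\varsigma(x,y)\varsigma(x+y,z)$ and $\lambda(x,y)\varsigma(x,y)\varsigma(y,x)^{-1}=1$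 for all $x,y,z\in\Gamma$; $\underline{\mathcal A}$ is the commutative algebra with the same underlying graded vector space as $\mathcal A$ and the product $a\star b=\varsigma(x,y)\,ab$ for $a\in\mathcal A^x$, $b\in\mathcal A^y$; and $J_\varsigma(X)_{ij}=\varsigma(0,\nu_j)\,\varsigma(\nu_i,-\nu_i+\nu_j)^{-1}X^i_{\;j}$. Finally, for every natural transformation $\Delta$ of group-valued functors from $\mathrm{GL}^0(\boldsymbol\nu;-)$ to $((-)^0)^\times$ there is an integer $t$ such that $\Delta_{\mathcal A}(X)=\mathrm{Gdet}^0_{\mathcal A}(X)^t$ for all $\mathcal A$ and all $X\in\mathrm{GL}^0(\boldsymbol\nu;\mathcal A)$. -/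

import Mathlib

open CategoryTheory DirectSum

universe u v

/-- A commutation factor on the abelian group `Γ` with values in `Kˣ`. -/
structure IsCommutationFactor {K : Type u} [Field K] {Γ : Type v} [AddCommGroup Γ]
    (lam : Γ → Γ → Kˣ) : Prop where
  mul_swap : ∀ x y, lam x y * lam y x = 1
  add_left : ∀ x y z, lam (x + y) z = lam x z * lam y z
  add_right : ∀ x y z, lam z (x + y) = lam z x * lam z y

/-- The even part of `Γ` with respect to `lam`. -/
def evenPart {K : Type u} [Field K] {Γ : Type v} (lam : Γ → Γ → Kˣ) : Set Γ :=
  {x | lam x x = 1}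

open Classical in
/-- The parity `Γ → ℤ/2` attached to `lam`: it is `0` exactly on the even part. -/
noncomputable def parity {K : Type u} [Field K] {Γ : Type v} (lam : Γ → Γ → Kˣ) (x : Γ) :
    ZMod 2 :=
  if x ∈ evenPart lam then 0 else 1

/-- The commutation factor `(a, b) ↦ (-1) ^ (a b)` on `ℤ/2`. -/
def superFactor (K : Type u) [Field K] (a b : ZMod 2) : Kˣ :=
  (-1) ^ (a * b).val

/-- A multiplier on `Γ`: a normalized 2-cocycle with values in `Kˣ`. -/
structure Multiplier (K : Type u) [Field K] (Γ : Type v) [AddCommGroup Γ] where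
  toFun : Γ → Γ → Kˣ
  cocycle : ∀ x y z, toFun x (y + z) * toFun y z = toFun x y * toFun (x + y) z
  map_zero : toFun 0 0 = 1

instance {K : Type u} [Field K] {Γ : Type v} [AddCommGroup Γ] :
    CoeFun (Multiplier K Γ) (fun _ => Γ → Γ → Kˣ) := ⟨Multiplier.toFun⟩

namespace Multiplier

variable {K : Type u} [Field K] {Γ : Type v} [AddCommGroup Γ] (s : Multiplier K Γ)

theorem zero_left (x : Γ) : s 0 x = 1 := by
  have h := s.cocycle 0 0 x
  rw [zero_add, zero_add, s.map_zero, one_mul] at h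
  exact mul_eq_right.mp h

theorem zero_right (x : Γ) : s x 0 = 1 := by
  have h := s.cocycle x 0 0
  rw [add_zero, add_zero, s.map_zero, mul_one] at h
  exact left_eq_mul.mp h

end Multiplier

/-- The commutation factor `lam ^ s`, obtained from `lam` by the change of multiplication
prescribed by the multiplier `s`. -/
def twistedFactor {K : Type u} [Field K] {Γ : Type v} [AddCommGroup Γ]
    (lam : Γ → Γ → Kˣ) (s : Multiplier K Γ) (x y : Γ) : Kˣ :=
  lam x y * s x y * (s y x)⁻¹

/-- The set `𝔖(lam)` of NS-multipliers: the multipliers for which the twisted commutation factor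
is the super commutation factor of the underlying parity. -/
def NSMultipliers {K : Type u} [Field K] {Γ : Type v} [AddCommGroup Γ] (lam : Γ → Γ → Kˣ) :
    Set (Multiplier K Γ) :=
  {s | ∀ x y, twistedFactor lam s x y = superFactor K (parity lam x) (parity lam y)}

theorem twistedFactor_eq_one {K : Type u} [Field K] {Γ : Type v} [AddCommGroup Γ]
    {lam : Γ → Γ → Kˣ} (heven : evenPart lam = Set.univ) {s : Multiplier K Γ}
    (hs : s ∈ NSMultipliers lam) (x y : Γ) : twistedFactor lam s x y = 1 := by
  rw [hs x y]
  simp [parity, heven, superFactor]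

/-- Objects of the category of `(Γ, lam)`-commutative algebras: associative unital `Γ`-graded
`K`-algebras in which `a b = lam x y • (b a)` for `a`, `b` homogeneous of degrees `x`, `y`. -/
structure GCAlg {K : Type u} [Field K] {Γ : Type v} [AddCommGroup Γ] [DecidableEq Γ]
    (lam : Γ → Γ → Kˣ) where
  carrier : Type u
  [ring : Ring carrier]
  [algebra : Algebra K carrier]
  deg : Γ → Submodule K carrier
  [graded : GradedAlgebra deg]
  comm : ∀ (x y : Γ) (a b : carrier), a ∈ deg x → b ∈ deg y →
    a * b = (lam x y : K) • (b * a)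

/-- The ring structure defined by an associative unital bilinear product. -/
@[reducible]
def ringOfBilinear {K : Type u} [Field K] {V : Type u} [AddCommGroup V] [Module K V]
    (m : V →ₗ[K] V →ₗ[K] V) (e : V) (hassoc : ∀ a b c, m (m a b) c = m a (m b c))
    (hone : ∀ a, m e a = a) (hone' : ∀ a, m a e = a) : Ring V :=
  { (inferInstance : AddCommGroup V) with
    mul := fun a b => m a b
    one := e
    mul_assoc := hassoc
    one_mul := hone
    mul_one := hone'
    left_distrib := fun a b c => map_add (m a) b c
    right_distrib := fun a b c => LinearMap.map_add₂ m a b c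
    zero_mul := fun a => LinearMap.map_zero₂ m a
    mul_zero := fun a => map_zero (m a) }

namespace GCAlg

variable {K : Type u} [Field K] {Γ : Type v} [AddCommGroup Γ] [DecidableEq Γ]
  {lam : Γ → Γ → Kˣ}

instance : CoeSort (GCAlg lam) (Type u) := ⟨GCAlg.carrier⟩

attribute [instance] GCAlg.ring GCAlg.algebra GCAlg.graded

/-- Morphisms are the morphisms of `K`-algebras preserving degrees. -/
instance : Category (GCAlg lam) where
  Hom A B := A.deg →ₐᵍ[K] B.deg
  id A := GradedAlgHom.id K A.deg
  comp f g := g.comp f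

/-- The morphism of `K`-algebras underlying a morphism of `(Γ, lam)`-commutative algebras. -/
def algHom {A B : GCAlg lam} (f : A ⟶ B) : A.carrier →ₐ[K] B.carrier :=
  GradedAlgHom.toAlgHom f

theorem algHom_mem {A B : GCAlg lam} (f : A ⟶ B) {x : Γ} {a : A.carrier} (ha : a ∈ A.deg x) :
    algHom f a ∈ B.deg x :=
  GradedAlgHom.map_mem f ha

theorem one_mem_deg (A : GCAlg lam) : (1 : A.carrier) ∈ A.deg 0 :=
  SetLike.one_mem_graded A.deg

/-- If `lam` is identically `1`, then a `(Γ, lam)`-commutative algebra is commutative. -/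
theorem mul_comm_of_one (A : GCAlg lam) (h : ∀ x y, lam x y = 1) (a b : A.carrier) :
    a * b = b * a := by
  induction a using Decomposition.inductionOn A.deg with
  | zero => simp
  | add a a' ha ha' => rw [add_mul, mul_add, ha, ha']
  | @homogeneous x a =>
    induction b using Decomposition.inductionOn A.deg with
    | zero => simp
    | add b b' hb hb' => rw [add_mul, mul_add, hb, hb']
    | @homogeneous y b => simpa [h] using A.comm x y a b a.2 b.2

/-- The commutative ring underlying a `(Γ, 1)`-commutative algebra. -/
@[reducible]
def commRing (A : GCAlg lam) (h : ∀ x y, lam x y = 1) : CommRing A.carrier :=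
  { A.ring with mul_comm := A.mul_comm_of_one h }

/-! ### The change of multiplication -/

section Twist

variable (A : GCAlg lam) (s : Multiplier K Γ)

/-- The linear map multiplying every homogeneous element of degree `y` by the scalar `c y`. -/
noncomputable def scale (c : Γ → Kˣ) : A.carrier →ₗ[K] A.carrier :=
  (DirectSum.toModule K Γ A.carrier (fun y => (c y : K) • (A.deg y).subtype)) ∘ₗ
    (decomposeLinearEquiv A.deg).toLinearMap

theorem scale_of_mem (c : Γ → Kˣ) {y : Γ} {b : A.carrier} (hb : b ∈ A.deg y) :
    A.scale c b = (c y : K) • b := by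
  lift b to A.deg y using hb
  simp only [scale, LinearMap.comp_apply, LinearEquiv.coe_coe, decomposeLinearEquiv_apply_coe,
    toModule_lof]
  simp

/-- The bilinear product `a ⋆ b`, determined by `a ⋆ b = s x y • (a b)` for `a`, `b` homogeneous
of degrees `x`, `y`. -/
noncomputable def star : A.carrier →ₗ[K] A.carrier →ₗ[K] A.carrier :=
  (DirectSum.toModule K Γ (A.carrier →ₗ[K] A.carrier)
    (fun x => (LinearMap.lcomp K A.carrier (A.scale (s x))) ∘ₗ
      (LinearMap.mul K A.carrier) ∘ₗ (A.deg x).subtype)) ∘ₗ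
    (decomposeLinearEquiv A.deg).toLinearMap

theorem star_of_mem {x y : Γ} {a b : A.carrier} (ha : a ∈ A.deg x) (hb : b ∈ A.deg y) :
    A.star s a b = (s x y : K) • (a * b) := by
  lift a to A.deg x using ha
  simp only [star, LinearMap.comp_apply, LinearEquiv.coe_coe, decomposeLinearEquiv_apply_coe,
    toModule_lof]
  simp [A.scale_of_mem (s x) hb]

theorem star_mem {x y : Γ} {a b : A.carrier} (ha : a ∈ A.deg x) (hb : b ∈ A.deg y) :
    A.star s a b ∈ A.deg (x + y) := by
  rw [A.star_of_mem s ha hb]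
  exact (A.deg (x + y)).smul_mem _ (SetLike.mul_mem_graded ha hb)

theorem one_star (a : A.carrier) : A.star s 1 a = a := by
  induction a using Decomposition.inductionOn A.deg with
  | zero => simp
  | add a a' ha ha' => rw [map_add, ha, ha']
  | @homogeneous x a =>
    rw [A.star_of_mem s (SetLike.one_mem_graded A.deg) a.2, s.zero_left]
    simp

theorem star_one (a : A.carrier) : A.star s a 1 = a := by
  induction a using Decomposition.inductionOn A.deg with
  | zero => simp
  | add a a' ha ha' => rw [map_add, LinearMap.add_apply, ha, ha']
  | @homogeneous x a =>
    rw [A.star_of_mem s a.2 (SetLike.one_mem_graded A.deg), s.zero_right]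
    simp

theorem star_assoc (a b c : A.carrier) :
    A.star s (A.star s a b) c = A.star s a (A.star s b c) := by
  induction a using Decomposition.inductionOn A.deg with
  | zero => simp
  | add a a' ha ha' => simp only [map_add, LinearMap.add_apply, ha, ha']
  | @homogeneous x a =>
    induction b using Decomposition.inductionOn A.deg with
    | zero => simp
    | add b b' hb hb' => simp only [map_add, LinearMap.add_apply, hb, hb']
    | @homogeneous y b =>
      induction c using Decomposition.inductionOn A.deg with
      | zero => simp
      | add c c' hc hc' => simp only [map_add, hc, hc']
      | @homogeneous z c =>
        rw [A.star_of_mem s (A.star_mem s a.2 b.2) c.2, A.star_of_mem s a.2 b.2,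
          A.star_of_mem s a.2 (A.star_mem s b.2 c.2), A.star_of_mem s b.2 c.2,
          smul_mul_assoc, mul_smul_comm, smul_smul, smul_smul, mul_assoc, ← Units.val_mul,
          ← Units.val_mul, s.cocycle, mul_comm (s x y)]

/-- The ring structure on `A` with multiplication `⋆`. -/
@[reducible]
noncomputable def starRing : Ring A.carrier :=
  ringOfBilinear (A.star s) 1 (A.star_assoc s) (A.one_star s) (A.star_one s)

/-- The `K`-algebra structure on `A` with multiplication `⋆` and unchanged scalar action. -/
@[reducible]
noncomputable def starAlgebra : @Algebra K A.carrier _ (A.starRing s).toSemiring :=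
  letI := A.starRing s
  letI : Module K A.carrier := A.algebra.toModule
  Algebra.ofModule (fun r a b => LinearMap.map_smul₂ (A.star s) r a b)
    (fun r a b => map_smul (A.star s a) r b)

/-- The value of the functor `I_s` on the object `A`: the same graded vector space, with
multiplication `⋆`. -/
noncomputable def twist : GCAlg (twistedFactor lam s) :=
  letI R := A.starRing s
  letI S := A.starAlgebra s
  { carrier := A.carrier
    ring := R
    algebra := S
    deg := A.deg
    graded :=
      { one_mem := A.one_mem_deg
        mul_mem := fun _ _ _ _ ha hb => A.star_mem s ha hb
        toDecomposition := A.graded.toDecomposition }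
    comm := fun x y a b ha hb => by
      change A.star s a b = (twistedFactor lam s x y : K) • A.star s b a
      rw [A.star_of_mem s ha hb, A.star_of_mem s hb ha, A.comm x y a b ha hb, smul_smul,
        smul_smul, ← Units.val_mul, ← Units.val_mul]
      congr 2
      rw [twistedFactor, inv_mul_cancel_right, mul_comm] }

/-- The identity map, from the vector space `A` to the twisted algebra. -/
noncomputable def toTwist : A.carrier ≃ₗ[K] (A.twist s).carrier :=
  LinearEquiv.refl K A.carrier

theorem toTwist_mul_toTwist {x y : Γ} {a b : A.carrier} (ha : a ∈ A.deg x) (hb : b ∈ A.deg y) :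
    A.toTwist s a * A.toTwist s b = A.toTwist s ((s x y : K) • (a * b)) :=
  A.star_of_mem s ha hb

end Twist

/-! ### Graded matrices -/

section Matrices

variable {n : ℕ} (nu : Fin n → Γ)

/-- The subalgebra `Mat⁰(nu; A)` of the matrices of degree `0`. -/
def mat0 (A : GCAlg lam) : Subalgebra K (Matrix (Fin n) (Fin n) A.carrier) where
  carrier := {X | ∀ i j, X i j ∈ A.deg (0 - nu i + nu j)}
  mul_mem' {X Y} hX hY i k := by
    rw [Matrix.mul_apply]
    refine Submodule.sum_mem _ fun j _ => ?_
    have h := SetLike.mul_mem_graded (hX i j) (hY j k)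
    rwa [show (0 - nu i + nu j) + (0 - nu j + nu k) = 0 - nu i + nu k by abel] at h
  add_mem' {X Y} hX hY i j := (A.deg _).add_mem (hX i j) (hY i j)
  algebraMap_mem' r i j := by
    rw [Matrix.algebraMap_matrix_apply]
    split_ifs with h
    · subst h
      rw [zero_sub, neg_add_cancel]
      exact SetLike.algebraMap_mem_graded A.deg r
    · exact (A.deg _).zero_mem

/-- A matrix of degree `0` is invertible in `Mat⁰(nu; A)` as soon as it is invertible as a
matrix. -/
theorem isUnit_mat0_iff (A : GCAlg lam) (X : A.mat0 nu) :
    IsUnit X ↔ IsUnit (X : Matrix (Fin n) (Fin n) A.carrier) := by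
  refine ⟨fun h => h.map (A.mat0 nu).val, ?_⟩
  rintro ⟨U, hU⟩
  set Z : Matrix (Fin n) (Fin n) A.carrier :=
    ((U⁻¹ : (Matrix (Fin n) (Fin n) A.carrier)ˣ) : Matrix (Fin n) (Fin n) A.carrier)
  have hXZ : (X : Matrix (Fin n) (Fin n) A.carrier) * Z = 1 := by rw [← hU]; exact U.mul_inv
  have hZX : Z * (X : Matrix (Fin n) (Fin n) A.carrier) = 1 := by rw [← hU]; exact U.inv_mul
  let Y : Matrix (Fin n) (Fin n) A.carrier :=
    Matrix.of fun i j => GradedAlgebra.proj A.deg (0 - nu i + nu j) (Z i j)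
  have hY : Y ∈ A.mat0 nu := fun i j => SetLike.coe_mem _
  have hXY : (X : Matrix (Fin n) (Fin n) A.carrier) * Y = 1 := by
    ext i k
    have h1 : (1 : Matrix (Fin n) (Fin n) A.carrier) i k ∈ A.deg (0 - nu i + nu k) :=
      (A.mat0 nu).one_mem i k
    have h2 : GradedAlgebra.proj A.deg (0 - nu i + nu k)
        (((X : Matrix (Fin n) (Fin n) A.carrier) * Z) i k) =
        (1 : Matrix (Fin n) (Fin n) A.carrier) i k := by
      rw [hXZ, GradedAlgebra.proj_apply, decompose_of_mem_same A.deg h1]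
    rw [← h2, Matrix.mul_apply, Matrix.mul_apply, map_sum]
    refine Finset.sum_congr rfl fun j _ => ?_
    rw [show 0 - nu i + nu k = (0 - nu i + nu j) + (0 - nu j + nu k) by abel,
      GradedAlgebra.proj_apply, coe_decompose_mul_add_of_left_mem A.deg (X.2 i j)]
    rfl
  have hYZ : Y = Z := by
    rw [← one_mul Y, ← hZX, mul_assoc, hXY, mul_one]
  exact ⟨⟨X, ⟨Y, hY⟩, Subtype.ext hXY, Subtype.ext ((congrArg (· * X.1) hYZ).trans hZX)⟩, rfl⟩

/-- The map induced on matrices of degree `0` by a morphism. -/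
def mat0Map {A B : GCAlg lam} (f : A ⟶ B) : A.mat0 nu →ₐ[K] B.mat0 nu :=
  ((algHom f).mapMatrix.comp (A.mat0 nu).val).codRestrict (B.mat0 nu)
    (fun X i j => algHom_mem f (X.2 i j))

/-- The functor `GL⁰(nu; -)`: invertible matrices of degree `0`, with the matrix product. -/
def GL0 : GCAlg lam ⥤ GrpCat.{u} where
  obj A := GrpCat.of (A.mat0 nu)ˣ
  map f := GrpCat.ofHom (Units.map (mat0Map nu f).toMonoidHom)
  map_id _ := rfl
  map_comp _ _ := rfl

/-- The map induced on elements of degree `0` by a morphism. -/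
def degZeroMap {A B : GCAlg lam} (f : A ⟶ B) : A.deg 0 →* B.deg 0 where
  toFun a := ⟨algHom f a, algHom_mem f a.2⟩
  map_one' := Subtype.ext (map_one (algHom f))
  map_mul' a b := Subtype.ext (map_mul (algHom f) a.1 b.1)

/-- The functor `((-)⁰)ˣ`: invertible elements of degree `0`. -/
def unitsDegZero : GCAlg lam ⥤ GrpCat.{u} where
  obj A := GrpCat.of (A.deg 0)ˣ
  map f := GrpCat.ofHom (Units.map (degZeroMap f))
  map_id _ := rfl
  map_comp _ _ := rfl

/-- The matrix `diag(1, …, 1, a)`, for `a` of degree `0`, as a matrix of degree `0`. -/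
def lastDiag (A : GCAlg lam) : A.deg 0 →* A.mat0 nu where
  toFun a := ⟨Matrix.diagonal fun i : Fin n => if (i : ℕ) + 1 = n then (a : A.carrier) else 1, by
    intro i j
    by_cases h : i = j
    · subst h
      rw [Matrix.diagonal_apply_eq, zero_sub, neg_add_cancel]
      split_ifs
      · exact a.2
      · exact SetLike.one_mem_graded A.deg
    · rw [Matrix.diagonal_apply_ne _ h]
      exact (A.deg _).zero_mem⟩
  map_one' := Subtype.ext (by simp)
  map_mul' a b := Subtype.ext <| Eq.symm <| (Matrix.diagonal_mul_diagonal _ _).trans <|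
    congrArg Matrix.diagonal <| funext fun i => by split_ifs <;> simp

/-- The map `J_s` on matrices of degree `x`, with values in the matrices over the twisted
algebra. -/
noncomputable def matJ (A : GCAlg lam) (s : Multiplier K Γ) (x : Γ)
    (X : Matrix (Fin n) (Fin n) A.carrier) : Matrix (Fin n) (Fin n) (A.twist s).carrier :=
  Matrix.of fun i j =>
    A.toTwist s (((s x (nu j) * (s (nu i) (x - nu i + nu j))⁻¹ : Kˣ) : K) • X i j)

/-- In the purely even case, the determinant `det (J_s X)` over the commutative algebra `I_s(A)`,
for an NS-multiplier `s` and a matrix `X` of degree `0`. -/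
noncomputable def detJ (heven : evenPart lam = Set.univ) {s : Multiplier K Γ}
    (hs : s ∈ NSMultipliers lam) (A : GCAlg lam) (X : A.mat0 nu) : (A.twist s).carrier :=
  letI := (A.twist s).commRing (twistedFactor_eq_one heven hs)
  Matrix.det (A.matJ nu s 0 X)

/-- The component at `A` of a natural transformation `GL⁰(nu; -) ⟶ ((-)⁰)ˣ` of group-valued
functors. -/
def component (D : GL0 (lam := lam) nu ⟶ unitsDegZero) (A : GCAlg lam) :
    (A.mat0 nu)ˣ →* (A.deg 0)ˣ :=
  (D.app A).hom

/-- The normalization `D (diag(1, …, 1, a)) = a`. -/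
def IsNormalized (D : GL0 (lam := lam) nu ⟶ unitsDegZero) : Prop :=
  ∀ (A : GCAlg lam) (a : (A.deg 0)ˣ), component nu D A (Units.map (A.lastDiag nu) a) = a

end Matrices

end GCAlg

/-! An NS-multiplier `s` turns each graded algebra `A` into a commutative algebra with the same
grading, and `J_s` turns degree-0 matrices over `A` multiplicatively into matrices over it. The
ordinary determinant then gives `gdet`, which is natural because the scalars in `J_s` do not depend
on `A`. NS-multipliers exist because an alternating bicharacter of a finitely generated group is the
commutator of its upper triangular half (`NSMultipliers_nonempty`).

Rigidity comes from test objects. For a commutative algebra `S`, the group algebra of `Γ` over `S`,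
twisted by the inverse of `s`, is `lam`-commutative, and its invertible degree-0 matrices receive a
homomorphism from the invertible matrices over `S`. A natural transformation `E` thus induces
natural homomorphisms from these to the units of `S`, and such homomorphisms are powers of `det`
(`exists_eq_detUnits_zpow_of_natural`). The coaction sending `a` of degree `x` to the monomial `a`
of degree `x` maps `A` to the test object over its own commutative form, and sends `X` to the image
of `J_s(X)` (`mat0Map_coaction`). Naturality along it recovers `E` on `A`
(`toUnderlying_component`), so `E` is a power of `gdet`. Normalization, tested on the scalar 2,
forces the exponent to be 1. -/

/-! ### Existence of NS-multipliers -/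

/-- A finitely generated abelian group admits finitely many endomorphisms with cyclic images
whose sum is the identity. -/
theorem exists_cyclic_projections (Γ : Type v) [AddCommGroup Γ] [AddGroup.FG Γ] :
    ∃ (m : ℕ) (g : Fin m → Γ) (p : Fin m → Γ →+ Γ),
      (∀ i x, ∃ k : ℤ, p i x = k • g i) ∧ ∀ x, ∑ i, p i x = x := by
  classical
  -- Any finite index type will do; reindexing by `Fin m` supplies the linear order needed to select
  -- half of a bicharacter.
  suffices h : ∃ (κ : Type) (_ : Fintype κ) (g : κ → Γ) (p : κ → Γ →+ Γ),
      (∀ i x, ∃ k : ℤ, p i x = k • g i) ∧ ∀ x, ∑ i, p i x = x by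
    obtain ⟨κ, _, g, p, h1, h2⟩ := h
    let e := (Fintype.equivFin κ).symm
    exact ⟨Fintype.card κ, g ∘ e, p ∘ e, fun i => h1 (e i), fun x =>
      (e.sum_comp fun i => p i x).trans (h2 x)⟩
  obtain ⟨n, ι, _, p, -, r, ⟨e⟩⟩ := AddCommGroup.equiv_free_prod_directSum_zmod Γ
  let P := (Fin n →₀ ℤ)
  let Q := ⨁ i : ι, ZMod (p i ^ r i)
  -- Inclusions `a`, `b` of the cyclic summands and the matching coordinates `a'`, `b'`; the
  -- composites are the projections.
  let a (i : Fin n) : ℤ →+ Γ :=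
    e.symm.toAddMonoidHom.comp ((AddMonoidHom.inl P Q).comp (Finsupp.singleAddHom i))
  let b (i : ι) : ZMod (p i ^ r i) →+ Γ :=
    e.symm.toAddMonoidHom.comp ((AddMonoidHom.inr P Q).comp
      (DirectSum.of (fun i : ι => ZMod (p i ^ r i)) i))
  let a' (i : Fin n) : Γ →+ ℤ :=
    (Finsupp.applyAddHom i).comp ((AddMonoidHom.fst P Q).comp e.toAddMonoidHom)
  let b' (i : ι) : Γ →+ ZMod (p i ^ r i) :=
    (DFinsupp.evalAddMonoidHom i).comp ((AddMonoidHom.snd P Q).comp e.toAddMonoidHom)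
  refine ⟨Fin n ⊕ ι, inferInstance, Sum.elim (fun i => a i 1) (fun i => b i 1),
    Sum.elim (fun i => (a i).comp (a' i)) (fun i => (b i).comp (b' i)), ?_, fun x => ?_⟩
  · rintro (i | i) x
    · exact ⟨a' i x, by
        simp only [Sum.elim_inl, AddMonoidHom.comp_apply, ← map_zsmul, smul_eq_mul, mul_one]⟩
    · refine ⟨(b' i x).cast, ?_⟩
      simp only [Sum.elim_inr, AddMonoidHom.comp_apply, ← map_zsmul]
      simp
  · rw [Fintype.sum_sum_type]
    apply e.injective
    simp only [Sum.elim_inl, Sum.elim_inr, map_add, map_sum, AddMonoidHom.comp_apply]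
    have ha : ∀ i, e (a i (a' i x)) = (Finsupp.single i ((e x).1 i), 0) := fun i =>
      e.apply_symm_apply _
    have hb : ∀ i, e (b i (b' i x)) =
        (0, DirectSum.of (fun i : ι => ZMod (p i ^ r i)) i ((e x).2 i)) := fun i =>
      e.apply_symm_apply _
    simp only [ha, hb]
    ext1
    · simp only [Prod.fst_add, Prod.fst_sum, Finset.sum_const_zero, add_zero]
      exact Finsupp.univ_sum_single _
    · simp only [Prod.snd_add, Prod.snd_sum, Finset.sum_const_zero, zero_add]
      exact DirectSum.sum_univ_of _

namespace IsCommutationFactor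

variable {K : Type u} [Field K] {Γ : Type v} [AddCommGroup Γ] {lam : Γ → Γ → Kˣ}

/-- A commutation factor as a homomorphism in its first variable. -/
def leftHom (h : IsCommutationFactor lam) (y : Γ) : Γ →+ Additive Kˣ :=
  AddMonoidHom.mk' (fun x => Additive.ofMul (lam x y)) fun a b => h.add_left a b y

/-- A commutation factor as a homomorphism in its second variable. -/
def rightHom (h : IsCommutationFactor lam) (x : Γ) : Γ →+ Additive Kˣ :=
  AddMonoidHom.mk' (fun y => Additive.ofMul (lam x y)) fun a b => h.add_right a b x

theorem zsmul_left (h : IsCommutationFactor lam) (k : ℤ) (x y : Γ) :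
    lam (k • x) y = lam x y ^ k :=
  map_zsmul (h.leftHom y) k x

theorem zsmul_right (h : IsCommutationFactor lam) (k : ℤ) (x y : Γ) :
    lam x (k • y) = lam x y ^ k :=
  map_zsmul (h.rightHom x) k y

theorem sum_left (h : IsCommutationFactor lam) {ι : Type*} (s : Finset ι) (f : ι → Γ) (y : Γ) :
    lam (∑ i ∈ s, f i) y = ∏ i ∈ s, lam (f i) y :=
  map_sum (h.leftHom y) f s

theorem sum_right (h : IsCommutationFactor lam) {ι : Type*} (s : Finset ι) (f : ι → Γ) (x : Γ) :
    lam x (∑ i ∈ s, f i) = ∏ i ∈ s, lam x (f i) :=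
  map_sum (h.rightHom x) f s

end IsCommutationFactor

theorem mem_NSMultipliers_iff {K : Type u} [Field K] {Γ : Type v} [AddCommGroup Γ]
    {lam : Γ → Γ → Kˣ} (heven : evenPart lam = Set.univ) {s : Multiplier K Γ} :
    s ∈ NSMultipliers lam ↔ ∀ x y, twistedFactor lam s x y = 1 := by
  simp [NSMultipliers, parity, heven, superFactor]

/-- Over a finitely generated group, an alternating commutation factor is the commutator of a
biadditive multiplier. -/
theorem NSMultipliers_nonempty {K : Type u} [Field K] {Γ : Type v} [AddCommGroup Γ]
    [AddGroup.FG Γ] {lam : Γ → Γ → Kˣ} (hlam : IsCommutationFactor lam)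
    (heven : evenPart lam = Set.univ) : (NSMultipliers lam).Nonempty := by
  classical
  obtain ⟨m, g, p, hp, hsum⟩ := exists_cyclic_projections Γ
  have hself : ∀ x, lam x x = 1 := fun x => by
    have : x ∈ evenPart lam := heven ▸ Set.mem_univ x
    exact this
  -- On a cyclic subgroup, `lam` is a power of `lam g g`, so pure evenness kills the diagonal terms.
  have hdiag : ∀ i x y, lam (p i x) (p i y) = 1 := fun i x y => by
    obtain ⟨k, hk⟩ := hp i x
    obtain ⟨l, hl⟩ := hp i y
    rw [hk, hl, hlam.zsmul_left, hlam.zsmul_right, hself, one_zpow, one_zpow]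
  -- Only the terms with `i < j` are kept: those with `j < i` are recovered by antisymmetry from the
  -- inverse of `t y x`.
  let f (x y : Γ) (i j : Fin m) : Kˣ := if i < j then lam (p i x) (p j y) else 1
  have hfl : ∀ x x' y i j, f (x + x') y i j = f x y i j * f x' y i j := fun x x' y i j => by
    simp only [f]; split_ifs <;> simp [hlam.add_left]
  have hfr : ∀ x y y' i j, f x (y + y') i j = f x y i j * f x y' i j := fun x y y' i j => by
    simp only [f]; split_ifs <;> simp [hlam.add_right]
  let t (x y : Γ) : Kˣ := ∏ i, ∏ j, f x y i j
  have htl : ∀ x x' y, t (x + x') y = t x y * t x' y := fun x x' y => by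
    simp only [t, hfl, Finset.prod_mul_distrib]
  have htr : ∀ x y y', t x (y + y') = t x y * t x y' := fun x y y' => by
    simp only [t, hfr, Finset.prod_mul_distrib]
  have hlt : ∀ x y, lam x y = t x y * (t y x)⁻¹ := fun x y => by
    conv_lhs => rw [← hsum x, ← hsum y]
    simp only [hlam.sum_left, hlam.sum_right]
    have : (t y x)⁻¹ = ∏ i, ∏ j, (f y x j i)⁻¹ := by
      rw [Finset.prod_comm]
      simp only [t, Finset.prod_inv_distrib]
    rw [this]
    simp only [t, ← Finset.prod_mul_distrib]
    refine Finset.prod_congr rfl fun i _ => Finset.prod_congr rfl fun j _ => ?_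
    have hinv : lam (p i x) (p j y) = (lam (p j y) (p i x))⁻¹ :=
      eq_inv_of_mul_eq_one_left (hlam.mul_swap _ _)
    rcases lt_trichotomy i j with h | rfl | h
    · simp [f, h, h.not_gt]
    · simp [f, hdiag]
    · simp [f, h, h.not_gt, hinv]
  -- The multiplier must cancel `lam`, hence the inverse of `t`; a biadditive map is automatically a
  -- cocycle.
  refine ⟨⟨fun x y => (t x y)⁻¹, fun x y z => ?_, ?_⟩, (mem_NSMultipliers_iff heven).2 fun x y => ?_⟩
  · rw [htl, htr, ← mul_inv, ← mul_inv]
    congr 1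
    ac_rfl
  · have := htl 0 0 0
    rw [add_zero] at this
    rw [left_eq_mul.mp this, inv_one]
  · simp [twistedFactor, hlt x y]

/-! ### Natural endomorphisms of the group of units -/

open Polynomial LaurentPolynomial in
/-- The units of the algebra of Laurent polynomials over a field are the nonzero monomials. -/
theorem LaurentPolynomial.exists_eq_C_mul_T_of_isUnit {K : Type u} [Field K]
    {f : LaurentPolynomial K} (hf : IsUnit f) :
    ∃ (c : K) (t : ℤ), f = LaurentPolynomial.C c * T t := by
  obtain ⟨g, hg⟩ := hf.exists_right_inv
  obtain ⟨m, p, hp⟩ := exists_T_pow f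
  obtain ⟨l, q, hq⟩ := exists_T_pow g
  have hpq : p * q = X ^ (m + l) := by
    apply Polynomial.toLaurent_injective
    rw [map_mul, hp, hq, Polynomial.toLaurent_X_pow]
    calc f * T m * (g * T l) = f * g * (T m * T l) := by ring
      _ = _ := by rw [hg, one_mul, ← T_add]; push_cast; rfl
  -- After clearing denominators, `p` divides a power of the prime `X`, so it is associated to some
  -- `X ^ i`.
  obtain ⟨i, -, w, hw⟩ := (dvd_prime_pow Polynomial.prime_X _).1 (Dvd.intro _ hpq)
  obtain ⟨c, hc, hcw⟩ := Polynomial.isUnit_iff.1 (w⁻¹).isUnit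
  refine ⟨c, i - m, ?_⟩
  have hp' : p = Polynomial.C c * X ^ i := by
    rw [← hw, hcw, mul_comm, mul_assoc, ← Units.val_mul, mul_inv_cancel, Units.val_one, mul_one]
  calc f = f * T m * T (-m) := by rw [mul_assoc, ← T_add, add_neg_cancel, T_zero, mul_one]
    _ = _ := by
      rw [← hp, hp', Polynomial.toLaurent_C_mul_X_pow, mul_assoc, ← T_add, sub_eq_add_neg]

/-- The natural endomorphisms of the functor of units on commutative algebras are the powers. -/
theorem exists_zpow_of_natural_units {K : Type u} [Field K]
    (χ : ∀ (S : Type u) [CommRing S] [Algebra K S], Sˣ →* Sˣ)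
    (hχ : ∀ (S S' : Type u) [CommRing S] [Algebra K S] [CommRing S'] [Algebra K S']
      (f : S →ₐ[K] S') (a : Sˣ), χ S' (Units.map f a) = Units.map f (χ S a)) :
    ∃ t : ℤ, ∀ (S : Type u) [CommRing S] [Algebra K S] (a : Sˣ), χ S a = a ^ t := by
  -- `T` is the universal unit: every unit of `S` is its image under an algebra map, so `χ` is
  -- determined by its value on `T`.
  let T : (LaurentPolynomial K)ˣ := (LaurentPolynomial.isUnit_T 1).unit
  obtain ⟨c, t, hct⟩ :=
    LaurentPolynomial.exists_eq_C_mul_T_of_isUnit (χ (LaurentPolynomial K) T).isUnit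
  have key : ∀ (S : Type u) [CommRing S] [Algebra K S] (a : Sˣ),
      (χ S a : S) = c • ((a ^ t : Sˣ) : S) := by
    intro S _ _ a
    let φ : LaurentPolynomial K →ₐ[K] S :=
      AddMonoidAlgebra.lift K S ℤ ((Units.coeHom S).comp (zpowersHom Sˣ a))
    have hφ : ∀ k : ℤ, φ (LaurentPolynomial.T k) = ((a ^ k : Sˣ) : S) := fun k => by
      refine (AddMonoidAlgebra.lift_single _ _ _).trans ?_
      simp
    have hT : Units.map (φ : LaurentPolynomial K →* S) T = a :=
      Units.ext ((hφ 1).trans (by rw [zpow_one]))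
    have h := congrArg Units.val (hχ _ S φ T)
    rw [hT] at h
    rw [h, Units.coe_map]
    refine (congrArg φ hct).trans ?_
    rw [map_mul, hφ, Algebra.smul_def]
    exact congrArg (· * _) (φ.commutes c)
  -- A homomorphism fixes 1, which rules out a constant factor.
  have hc : c = 1 := by simpa using (key K 1).symm
  exact ⟨t, fun S _ _ a => Units.ext (by rw [key, hc, one_smul])⟩

/-! ### Natural homomorphisms from invertible matrices to units -/

section Determinant

open Matrix

variable {n : Type*} [Fintype n] [DecidableEq n]

/-- The determinant of invertible matrices. -/
def detUnits (n : Type*) [Fintype n] [DecidableEq n] (S : Type*) [CommRing S] :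
    (Matrix n n S)ˣ →* Sˣ := Units.map detMonoidHom

/-- The invertible diagonal matrices. -/
def diagPiUnits (n : Type*) [Fintype n] [DecidableEq n] (S : Type*) [CommRing S] :
    (n → Sˣ) →* (Matrix n n S)ˣ :=
  (Units.map (diagonalRingHom n S : (n → S) →* Matrix n n S)).comp
    (MulEquiv.piUnits (M := fun _ : n => S)).symm.toMonoidHom

/-- The invertible diagonal matrices whose entries are all `1` but the one at `i`. -/
def diagUnits (i : n) (S : Type*) [CommRing S] : Sˣ →* (Matrix n n S)ˣ :=
  (diagPiUnits n S).comp (MonoidHom.mulSingle (fun _ : n => Sˣ) i)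

theorem coe_diagUnits (i : n) (S : Type*) [CommRing S] (a : Sˣ) :
    (diagUnits i S a : Matrix n n S) = diagonal fun k => if k = i then (a : S) else 1 :=
  congrArg diagonal <| funext fun k => by
    change ((Pi.mulSingle i a : n → Sˣ) k : S) = _
    rw [Pi.mulSingle_apply]
    split_ifs <;> rfl

theorem coe_detUnits (S : Type*) [CommRing S] (U : (Matrix n n S)ˣ) :
    (detUnits n S U : S) = det (U : Matrix n n S) := rfl

theorem detUnits_diagUnits (i : n) (S : Type*) [CommRing S] (a : Sˣ) :
    detUnits n S (diagUnits i S a) = a :=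
  Units.ext (by rw [coe_detUnits, coe_diagUnits, det_diagonal]; simp)

/-- Diagonal matrices with one prescribed entry are conjugate to each other. -/
theorem isConj_diagUnits (i j : n) (S : Type*) [CommRing S] (a : Sˣ) :
    IsConj (diagUnits i S a) (diagUnits j S a) := by
  let P : Matrix n n S := (Equiv.swap i j).permMatrix S
  have hP : P * P = 1 := by
    simp only [P]
    rw [PEquiv.toMatrix_toPEquiv_mul]
    ext a b
    simp [one_apply, PEquiv.toMatrix_apply, Equiv.toPEquiv_apply]
  refine ⟨toUnits ⟨P, P, hP, hP⟩, Units.ext ?_⟩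
  change P * (diagUnits i S a : Matrix n n S) = (diagUnits j S a : Matrix n n S) * P
  rw [coe_diagUnits, coe_diagUnits, PEquiv.toMatrix_toPEquiv_mul, PEquiv.mul_toMatrix_toPEquiv]
  ext k l
  simp only [submatrix_apply, diagonal_apply, id, Equiv.symm_swap, Equiv.swap_apply_def]
  grind

/-- A transvection as an invertible matrix. -/
def transvectionUnit {S : Type*} [CommRing S] {i j : n} (h : i ≠ j) (c : S) : (Matrix n n S)ˣ where
  val := transvection i j c
  inv := transvection i j (-c)
  val_inv := by rw [transvection_mul_transvection_same _ _ h, add_neg_cancel, transvection_zero]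
  inv_val := by rw [transvection_mul_transvection_same _ _ h, neg_add_cancel, transvection_zero]

/-- If `2` is invertible, then transvections die in every abelian quotient. -/
theorem map_transvectionUnit {S : Type*} [CommRing S] {G : Type*} [CommGroup G]
    (e : (Matrix n n S)ˣ →* G) (h2 : IsUnit (2 : S)) {i j : n} (h : i ≠ j) (c : S) :
    e (transvectionUnit h c) = 1 := by
  -- Doubling the parameter of a transvection is both squaring it and conjugating it by a diagonal
  -- matrix with entry 2; in an abelian group the image then equals its own square.
  have hsq : transvectionUnit h c * transvectionUnit h c = transvectionUnit h (2 * c) :=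
    Units.ext (by
      rw [Units.val_mul, two_mul]
      exact transvection_mul_transvection_same _ _ h c c)
  have hconj : diagUnits i S h2.unit * transvectionUnit h c =
      transvectionUnit h (2 * c) * diagUnits i S h2.unit := by
    refine Units.ext ?_
    rw [Units.val_mul, Units.val_mul, coe_diagUnits]
    ext a b
    rw [diagonal_mul, mul_diagonal]
    simp only [transvectionUnit, transvection, Matrix.add_apply, single_apply, one_apply,
      IsUnit.unit_spec]
    grind
  have h1 := congrArg e hconj
  rw [map_mul, map_mul, mul_comm, mul_left_inj, ← hsq, map_mul] at h1
  exact left_eq_mul.mp h1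

/-- Over a field of characteristic different from `2`, a homomorphism from invertible matrices to
an abelian group agrees with the `t`-th power of the determinant as soon as it does so on diagonal
matrices with one prescribed entry. -/
theorem eq_detUnits_zpow_of_field {F : Type*} [Field F] (h2 : (2 : F) ≠ 0)
    (e : (Matrix n n F)ˣ →* Fˣ) (t : ℤ) (he : ∀ i a, e (diagUnits i F a) = a ^ t)
    (U : (Matrix n n F)ˣ) : e U = detUnits n F U ^ t := by
  -- The induction principle runs over matrices, so the claim is quantified over all units with a
  -- given underlying matrix.
  suffices h : ∀ M : Matrix n n F, det M ≠ 0 →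
      ∀ U : (Matrix n n F)ˣ, (U : Matrix n n F) = M → e U = detUnits n F U ^ t from
    h U ((U.isUnit.map detMonoidHom).ne_zero) U rfl
  intro M hM
  refine diagonal_transvection_induction_of_det_ne_zero
    (fun M => ∀ U : (Matrix n n F)ˣ, (U : Matrix n n F) = M → e U = detUnits n F U ^ t)
    M hM ?_ ?_ ?_
  · intro D hD U hU
    rw [det_diagonal, Finset.prod_ne_zero_iff] at hD
    have hU' : U = diagPiUnits n F fun i => Units.mk0 (D i) (hD i (Finset.mem_univ i)) :=
      Units.ext hU
    have h : e.comp (diagPiUnits n F) =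
        ((zpowGroupHom t).comp (detUnits n F)).comp (diagPiUnits n F) := by
      refine MonoidHom.pi_ext fun i a => (he i a).trans ?_
      exact congrArg (· ^ t) (detUnits_diagUnits i F a).symm
    rw [hU']
    exact DFunLike.congr_fun h _
  · rintro ⟨i, j, hij, c⟩ U hU
    have : U = transvectionUnit hij c := Units.ext hU
    rw [this, map_transvectionUnit e h2.isUnit]
    have h1 : detUnits n F (transvectionUnit hij c) = 1 :=
      Units.ext (det_transvection_of_ne i j hij c)
    rw [h1, _root_.one_zpow]
  · intro A B hA hB ihA ihB U hU
    let a := nonsingInvUnit A hA.isUnit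
    let b := nonsingInvUnit B hB.isUnit
    have : U = a * b := Units.ext hU
    rw [this, map_mul, map_mul, mul_zpow, ihA a rfl, ihB b rfl]

/-- A homomorphism from invertible matrices to units which is natural on commutative algebras over
a field of characteristic different from `2` is a power of the determinant. -/
theorem exists_eq_detUnits_zpow_of_natural {n : Type} [Fintype n] [DecidableEq n] [Nonempty n]
    {K : Type u} [Field K] (h2 : (2 : K) ≠ 0)
    (e : ∀ (S : Type u) [CommRing S] [Algebra K S], (Matrix n n S)ˣ →* Sˣ)
    (hnat : ∀ (S S' : Type u) [CommRing S] [Algebra K S] [CommRing S'] [Algebra K S']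
      (f : S →ₐ[K] S') (U : (Matrix n n S)ˣ),
      e S' (Units.map (f.mapMatrix : Matrix n n S →ₐ[K] Matrix n n S') U) =
        Units.map f (e S U)) :
    ∃ t : ℤ, ∀ (S : Type u) [CommRing S] [Algebra K S] (U : (Matrix n n S)ˣ),
      e S U = detUnits n S U ^ t := by
  obtain ⟨i₀⟩ := ‹Nonempty n›
  obtain ⟨t, ht⟩ := exists_zpow_of_natural_units (K := K)
    (fun S _ _ => (e S).comp (diagUnits i₀ S)) fun S S' _ _ _ _ f a => by
      simp only [MonoidHom.comp_apply]
      rw [← hnat]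
      congr 1
      refine Units.ext ?_
      refine (coe_diagUnits i₀ S' (Units.map (f : S →* S') a)).trans ?_
      change _ = ((diagUnits i₀ S a : (Matrix n n S)ˣ) : Matrix n n S).map f
      rw [coe_diagUnits, diagonal_map (map_zero f)]
      congr 1
      ext k
      split_ifs <;> simp [*]
  have hfield : ∀ (F : Type u) [Field F] [Algebra K F] (U : (Matrix n n F)ˣ),
      e F U = detUnits n F U ^ t := fun F _ _ U => by
    refine eq_detUnits_zpow_of_field ?_ (e F) t (fun i a => ?_) U
    · rw [← map_ofNat (algebraMap K F) 2]
      exact (map_ne_zero (algebraMap K F)).2 h2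
    · rw [← ht F a, MonoidHom.comp_apply]
      -- The exponent found at `i₀` serves every position, since conjugate elements agree in an
      -- abelian group.
      exact isConj_iff_eq.1 ((e F).map_isConj (isConj_diagUnits i i₀ F a))
  have hdet : ∀ (S S' : Type u) [CommRing S] [Algebra K S] [CommRing S'] [Algebra K S']
      (f : S →ₐ[K] S') (U : (Matrix n n S)ˣ),
      detUnits n S' (Units.map (f.mapMatrix : Matrix n n S →ₐ[K] Matrix n n S') U) =
        Units.map f (detUnits n S U) := fun S S' _ _ _ _ f U =>
    Units.ext (f.map_det (U : Matrix n n S)).symm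
  -- `R` is the polynomial ring in the matrix entries with the determinant inverted, and `G` is the
  -- universal invertible matrix over it.
  let P := MvPolynomial (n × n) K
  let d : P := det (mvPolynomialX n n K)
  have hd : d ≠ 0 := det_mvPolynomialX_ne_zero n K
  let R := Localization.Away d
  have : IsDomain R := IsLocalization.isDomain_localization
    (powers_le_nonZeroDivisors_of_noZeroDivisors hd)
  let g : Matrix n n R := (mvPolynomialX n n K).map (algebraMap P R)
  have hg : IsUnit (det g) := by
    have := RingHom.map_det (algebraMap P R) (mvPolynomialX n n K)
    rw [RingHom.mapMatrix_apply] at this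
    rw [← this]
    exact IsLocalization.Away.algebraMap_isUnit d
  let G : (Matrix n n R)ˣ := nonsingInvUnit g hg
  -- `R` is a domain, so its units embed in those of its fraction field, where the field case
  -- applies.
  have hG : e R G = detUnits n R G ^ t := by
    let φ : R →ₐ[K] FractionRing R := IsScalarTower.toAlgHom K R (FractionRing R)
    have hφ : Function.Injective φ := IsFractionRing.injective R (FractionRing R)
    apply Units.map_injective (f := (φ : R →* FractionRing R)) hφ
    rw [← hnat, hfield, hdet, map_zpow]
  refine ⟨t, fun S _ _ U => ?_⟩
  -- Specializing the generic entries to those of `U` extends to `R` because `det U` is a unit.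
  let ψ : P →ₐ[K] S := MvPolynomial.aeval fun p => (U : Matrix n n S) p.1 p.2
  have hψ : ψ.mapMatrix (mvPolynomialX n n K) = (U : Matrix n n S) :=
    mvPolynomialX_mapMatrix_aeval K (U : Matrix n n S)
  have hψd : IsUnit (ψ d) := by
    rw [AlgHom.map_det, hψ]
    exact (detUnits n S U).isUnit
  let θ : R →ₐ[K] S := IsLocalization.liftAlgHom (M := Submonoid.powers d) (f := ψ) (by
    rintro ⟨_, k, rfl⟩
    rw [map_pow]
    exact hψd.pow k)
  have hθ : Units.map (θ.mapMatrix : Matrix n n R →ₐ[K] Matrix n n S) G = U := by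
    refine Units.ext (Eq.trans ?_ hψ)
    ext i j
    exact IsLocalization.lift_eq _ _
  rw [← hθ, hnat, hG, map_zpow, hdet]

end Determinant

/-! ### Undoing a twist, and the underlying commutative algebra -/

namespace Multiplier

/-- The pointwise inverse of a multiplier. -/
instance {K : Type u} [Field K] {Γ : Type v} [AddCommGroup Γ] : Inv (Multiplier K Γ) :=
  ⟨fun s => ⟨fun x y => (s x y)⁻¹, fun x y z => by
    rw [← mul_inv, s.cocycle, mul_inv], by rw [s.map_zero, inv_one]⟩⟩

theorem inv_apply {K : Type u} [Field K] {Γ : Type v} [AddCommGroup Γ] (s : Multiplier K Γ)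
    (x y : Γ) : s⁻¹ x y = (s x y)⁻¹ := rfl

end Multiplier

/-- The NS condition expresses `lam` as the commutator of the inverse of `s`. Twisting a commutative
graded algebra by that inverse therefore yields a `lam`-commutative one, the source of the test
objects. -/
theorem twistedFactor_one_inv {K : Type u} [Field K] {Γ : Type v} [AddCommGroup Γ]
    {lam : Γ → Γ → Kˣ} {s : Multiplier K Γ} (h : ∀ x y, twistedFactor lam s x y = 1) :
    twistedFactor (fun _ _ : Γ => (1 : Kˣ)) s⁻¹ = lam := by
  funext x y
  have := h x y
  rw [twistedFactor, mul_assoc] at this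
  rw [twistedFactor, one_mul, Multiplier.inv_apply, Multiplier.inv_apply,
    eq_inv_of_mul_eq_one_left this, mul_inv]

namespace GCAlg

variable {K : Type u} [Field K] {Γ : Type v} [AddCommGroup Γ] [DecidableEq Γ]
  {lam : Γ → Γ → Kˣ}

/-- A degree preserving linear map which respects the unit and products of homogeneous elements is
a morphism. -/
def homOfLinear {A B : GCAlg lam} (f : A.carrier →ₗ[K] B.carrier) (hone : f 1 = 1)
    (hdeg : ∀ x, ∀ a ∈ A.deg x, f a ∈ B.deg x)
    (hmul : ∀ x y, ∀ a ∈ A.deg x, ∀ b ∈ A.deg y, f (a * b) = f a * f b) : A ⟶ B :=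
  ({ AlgHom.ofLinearMap f hone (fun a b => by
      induction a using Decomposition.inductionOn A.deg with
      | zero => simp
      | add a a' ha ha' => rw [add_mul, map_add, ha, ha', map_add, add_mul]
      | @homogeneous x a =>
        induction b using Decomposition.inductionOn A.deg with
        | zero => simp
        | add b b' hb hb' => rw [mul_add, map_add, hb, hb', map_add, mul_add]
        | @homogeneous y b => exact hmul x y a a.2 b b.2) with
    map_mem := fun {x a} ha => hdeg x a ha } : A.deg →ₐᵍ[K] B.deg)

/-- Transport of an algebra along an equality of commutation factors. -/
def ofEq {mu : Γ → Γ → Kˣ} (h : mu = lam) (A : GCAlg mu) : GCAlg lam where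
  carrier := A.carrier
  ring := A.ring
  algebra := A.algebra
  deg := A.deg
  graded := A.graded
  comm := h ▸ A.comm

section Underlying

variable (heven : evenPart lam = Set.univ) {s : Multiplier K Γ} (hs : s ∈ NSMultipliers lam)

/-- The commutative algebra obtained from `A` by the change of multiplication prescribed by an
NS-multiplier. -/
def Underlying (_ : evenPart lam = Set.univ) {s : Multiplier K Γ} (_ : s ∈ NSMultipliers lam)
    (A : GCAlg lam) : Type u := (A.twist s).carrier

noncomputable instance (A : GCAlg lam) : CommRing (Underlying heven hs A) :=
  (A.twist s).commRing (twistedFactor_eq_one heven hs)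

noncomputable instance (A : GCAlg lam) : Algebra K (Underlying heven hs A) :=
  (A.twist s).algebra

/-- The identity map from an algebra to its underlying commutative algebra. -/
noncomputable def toUnderlying (A : GCAlg lam) : A.carrier ≃ₗ[K] Underlying heven hs A :=
  A.toTwist s

theorem toUnderlying_mul {A : GCAlg lam} {x y : Γ} {a b : A.carrier} (ha : a ∈ A.deg x)
    (hb : b ∈ A.deg y) : toUnderlying heven hs A a * toUnderlying heven hs A b =
      toUnderlying heven hs A ((s x y : K) • (a * b)) :=
  A.toTwist_mul_toTwist s ha hb

theorem toUnderlying_one (A : GCAlg lam) : toUnderlying heven hs A 1 = 1 := rfl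

end Underlying

theorem component_naturality {n : ℕ} {nu : Fin n → Γ} (E : GL0 (lam := lam) nu ⟶ unitsDegZero)
    {A B : GCAlg lam} (f : A ⟶ B) (X : (A.mat0 nu)ˣ) :
    component nu E B (Units.map (mat0Map nu f : A.mat0 nu →* B.mat0 nu) X) =
      Units.map (degZeroMap f) (component nu E A X) :=
  ConcreteCategory.congr_hom (E.naturality f) X

/-! ### Twisted group algebras as test objects -/

section GroupAlgebra

variable [Small.{u} Γ]

open AddMonoidAlgebra in
/-- The group algebra of `Γ` with coefficients in a commutative algebra `S`. -/
noncomputable def groupAlgebra (S : Type u) [CommRing S] [Algebra K S] :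
    GCAlg (fun _ _ : Γ => (1 : Kˣ)) where
  carrier := AddMonoidAlgebra S (Shrink.{u} Γ)
  deg γ := (gradeBy S (Shrink.addEquiv (α := Γ)).toAddMonoidHom γ).restrictScalars K
  graded :=
    let G := gradeBy.gradedAlgebra (R := S) (Shrink.addEquiv (α := Γ)).toAddMonoidHom
    { one_mem := G.one_mem
      mul_mem := G.mul_mem
      decompose' := G.decompose'
      left_inv := G.left_inv
      right_inv := G.right_inv }
  comm _ _ a b _ _ := by rw [mul_comm, Units.val_one, one_smul]

variable {s : Multiplier K Γ} (h : ∀ x y, twistedFactor lam s x y = 1)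

/-- The group algebra of `Γ` with coefficients in a commutative algebra `S`, twisted by the
inverse of the multiplier `s`. -/
noncomputable def twistedGroupAlgebra (S : Type u) [CommRing S] [Algebra K S] : GCAlg lam :=
  ofEq (twistedFactor_one_inv h) ((groupAlgebra S).twist s⁻¹)

variable {S S' : Type u} [CommRing S] [Algebra K S] [CommRing S'] [Algebra K S']

/-- The monomial of degree `x` with coefficient `a`. -/
noncomputable def monomial (x : Γ) : S →ₗ[K] (twistedGroupAlgebra h S).carrier where
  toFun a := (groupAlgebra S).toTwist s⁻¹ (AddMonoidAlgebra.single (equivShrink Γ x) a)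
  map_add' a b := by rw [AddMonoidAlgebra.single_add]; rfl
  map_smul' c a := by rw [← AddMonoidAlgebra.smul_single]; rfl

/-- The coefficient of degree `x`. -/
noncomputable def coeff (x : Γ) : (twistedGroupAlgebra h S).carrier →ₗ[K] S where
  toFun a := AddMonoidAlgebra.coeff (((groupAlgebra S).toTwist s⁻¹).symm a) (equivShrink Γ x)
  map_add' _ _ := rfl
  map_smul' _ _ := rfl

theorem monomial_mem (x : Γ) (a : S) : monomial h x a ∈ (twistedGroupAlgebra h S).deg x := by
  have := AddMonoidAlgebra.single_mem_gradeBy (Shrink.addEquiv (α := Γ)).toAddMonoidHom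
    (equivShrink Γ x) a
  have hx : (Shrink.addEquiv (α := Γ)).toAddMonoidHom (equivShrink Γ x) = x :=
    (equivShrink Γ).symm_apply_apply x
  rw [hx] at this
  exact this

theorem coeff_monomial (x : Γ) (a : S) : coeff h x (monomial h x a) = a :=
  Finsupp.single_eq_same

theorem monomial_coeff {x : Γ} {a : (twistedGroupAlgebra h S).carrier}
    (ha : a ∈ (twistedGroupAlgebra h S).deg x) : monomial h x (coeff h x a) = a := by
  classical
  let b : AddMonoidAlgebra S (Shrink.{u} Γ) := ((groupAlgebra S).toTwist s⁻¹).symm a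
  -- Membership in a component of `gradeBy` unfolds to this condition on the support.
  have hb : ∀ m ∈ b.coeff.support, (equivShrink Γ).symm m = x := ha
  change AddMonoidAlgebra.single (equivShrink Γ x) (b.coeff (equivShrink Γ x)) = b
  refine AddMonoidAlgebra.coeff_injective (Finsupp.ext fun m => ?_)
  rw [AddMonoidAlgebra.coeff_single, Finsupp.single_apply]
  split_ifs with hm
  · rw [hm]
  · by_contra hne
    exact hm ((Equiv.symm_apply_eq _).1 (hb m (Finsupp.mem_support_iff.2 (Ne.symm hne)))).symm

/-- The scalar is inverse to `s` because the twist is by the inverse multiplier; it is what later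
cancels the `s` in the product of the underlying commutative algebra. -/
theorem monomial_mul (x y : Γ) (a b : S) :
    monomial h x a * monomial h y b = monomial h (x + y) (((s x y)⁻¹ : Kˣ) • (a * b)) := by
  refine ((groupAlgebra S).toTwist_mul_toTwist s⁻¹ (monomial_mem h x a)
    (monomial_mem h y b)).trans ?_
  rw [map_smul, Multiplier.inv_apply]
  change _ = monomial h (x + y) ((((s x y)⁻¹ : Kˣ) : K) • (a * b))
  rw [map_smul]
  refine congrArg ((((s x y)⁻¹ : Kˣ) : K) • ·) ?_
  refine congrArg ((groupAlgebra S).toTwist s⁻¹)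
    ((AddMonoidAlgebra.single_mul_single _ _ _ _).trans ?_)
  rw [equivShrink_add]
  rfl

theorem monomial_zero_one : monomial h 0 (1 : S) = 1 := by
  change AddMonoidAlgebra.single (equivShrink Γ 0) (1 : S) = 1
  rw [show equivShrink Γ 0 = 0 from rfl]
  rfl

/-- The linear map applying a morphism of algebras of coefficients. -/
noncomputable def mapCoeff (f : S →ₐ[K] S') :
    (twistedGroupAlgebra h S).carrier →ₗ[K] (twistedGroupAlgebra h S').carrier :=
  ((groupAlgebra S').toTwist s⁻¹).toLinearMap ∘ₗ
    (AddMonoidAlgebra.mapAlgHom (Shrink.{u} Γ) f).toLinearMap ∘ₗ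
    ((groupAlgebra S).toTwist s⁻¹).symm.toLinearMap

theorem mapCoeff_monomial (f : S →ₐ[K] S') (x : Γ) (a : S) :
    mapCoeff h f (monomial h x a) = monomial h x (f a) :=
  AddMonoidAlgebra.mapAlgHom_single _ _ _

/-- The twisted group algebra is functorial in the algebra of coefficients. -/
noncomputable def twistedGroupAlgebraMap (f : S →ₐ[K] S') :
    twistedGroupAlgebra h S ⟶ twistedGroupAlgebra h S' :=
  homOfLinear (mapCoeff h f)
    (by rw [← monomial_zero_one, mapCoeff_monomial, map_one, monomial_zero_one])
    (fun x a ha => by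
      rw [← monomial_coeff h ha, mapCoeff_monomial]
      exact monomial_mem h x _)
    (fun x y a ha b hb => by
      rw [← monomial_coeff h ha, ← monomial_coeff h hb, monomial_mul, mapCoeff_monomial,
        mapCoeff_monomial, mapCoeff_monomial, monomial_mul, Units.smul_def, Units.smul_def,
        map_smul, map_mul])

theorem algHom_twistedGroupAlgebraMap (f : S →ₐ[K] S') (x : Γ) (a : S) :
    algHom (twistedGroupAlgebraMap h f) (monomial h x a) = monomial h x (f a) :=
  mapCoeff_monomial h f x a

/-- The coefficient of degree `0`, as a multiplicative map on elements of degree `0`. -/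
noncomputable def coeffZero (S : Type u) [CommRing S] [Algebra K S] :
    (twistedGroupAlgebra h S).deg 0 →* S where
  toFun a := coeff h 0 a.1
  map_one' := by
    change coeff h 0 (1 : (twistedGroupAlgebra h S).carrier) = 1
    rw [← monomial_zero_one, coeff_monomial]
  map_mul' a b := by
    change coeff h 0 (a.1 * b.1) = _
    conv_lhs => rw [← monomial_coeff h a.2, ← monomial_coeff h b.2, monomial_mul, s.map_zero,
      inv_one, one_smul, add_zero, coeff_monomial]

theorem monomial_coeffZero (a : (twistedGroupAlgebra h S).deg 0) :
    monomial h 0 (coeffZero h S a) = a.1 :=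
  monomial_coeff h a.2

theorem coeffZero_degZeroMap (f : S →ₐ[K] S') (a : (twistedGroupAlgebra h S).deg 0) :
    coeffZero h S' (degZeroMap (twistedGroupAlgebraMap h f) a) = f (coeffZero h S a) := by
  change coeff h 0 (algHom (twistedGroupAlgebraMap h f) a.1) = _
  rw [← monomial_coeffZero h a, algHom_twistedGroupAlgebraMap, coeff_monomial]

variable {n : ℕ} (nu : Fin n → Γ)

/-- Every matrix over a commutative algebra gives rise to a matrix of degree `0` over the twisted
group algebra. -/
noncomputable def monomialMatrix (S : Type u) [CommRing S] [Algebra K S] :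
    Matrix (Fin n) (Fin n) S →* (twistedGroupAlgebra h S).mat0 nu where
  toFun M := ⟨Matrix.of fun i j =>
    monomial h (0 - nu i + nu j) ((s (nu i) (0 - nu i + nu j)) • M i j), fun i j =>
    monomial_mem h _ _⟩
  map_one' := Subtype.ext <| by
    ext i j
    simp only [Matrix.of_apply, OneMemClass.coe_one, Matrix.one_apply]
    split_ifs with hij
    · subst hij
      rw [show 0 - nu i + nu i = 0 by abel, s.zero_right, one_smul, monomial_zero_one]
    · rw [smul_zero, map_zero]
  map_mul' M N := Subtype.ext <| by
    ext i k
    simp only [Matrix.of_apply, MulMemClass.coe_mul, Matrix.mul_apply, monomial_mul]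
    rw [Finset.smul_sum, map_sum]
    refine Finset.sum_congr rfl fun j _ => ?_
    have hadd : 0 - nu i + nu k = (0 - nu i + nu j) + (0 - nu j + nu k) := by abel
    -- The cocycle identity makes the scalar of the `j`-th summand independent of `j`.
    have hc := s.cocycle (nu i) (0 - nu i + nu j) (0 - nu j + nu k)
    rw [show nu i + (0 - nu i + nu j) = nu j by abel] at hc
    rw [hadd, smul_mul_smul_comm, smul_smul, ← hc, mul_comm (s (nu i) _), inv_mul_cancel_left]

theorem mat0Map_monomialMatrix (f : S →ₐ[K] S') (M : Matrix (Fin n) (Fin n) S) :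
    mat0Map nu (twistedGroupAlgebraMap h f) (monomialMatrix h nu S M) =
      monomialMatrix h nu S' (f.mapMatrix M) := Subtype.ext <| by
  ext i j
  refine (algHom_twistedGroupAlgebraMap h f _ _).trans ?_
  rw [Units.smul_def, map_smul]
  rfl

/-- A natural transformation between the functors of invertible matrices and of invertible
elements of degree `0` induces a homomorphism from invertible matrices to units over every
commutative algebra. -/
noncomputable def componentOnCommutative (E : GL0 (lam := lam) nu ⟶ unitsDegZero)
    (S : Type u) [CommRing S] [Algebra K S] : (Matrix (Fin n) (Fin n) S)ˣ →* Sˣ :=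
  (Units.map (coeffZero h S)).comp
    ((component nu E (twistedGroupAlgebra h S)).comp (Units.map (monomialMatrix h nu S)))

/-- Only naturality of `E` along changes of coefficients in twisted group algebras is needed. -/
theorem componentOnCommutative_naturality (E : GL0 (lam := lam) nu ⟶ unitsDegZero)
    (f : S →ₐ[K] S') (U : (Matrix (Fin n) (Fin n) S)ˣ) :
    componentOnCommutative h nu E S'
        (Units.map (f.mapMatrix : Matrix (Fin n) (Fin n) S →ₐ[K] Matrix (Fin n) (Fin n) S') U) =
      Units.map f (componentOnCommutative h nu E S U) := by
  have hU : Units.map (monomialMatrix h nu S')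
      (Units.map (f.mapMatrix : Matrix (Fin n) (Fin n) S →ₐ[K] Matrix (Fin n) (Fin n) S') U) =
      Units.map (mat0Map nu (twistedGroupAlgebraMap h f) : _ →* _)
        (Units.map (monomialMatrix h nu S) U) :=
    Units.ext (mat0Map_monomialMatrix h nu f U.1).symm
  simp only [componentOnCommutative, MonoidHom.comp_apply]
  rw [hU, component_naturality]
  exact Units.ext (coeffZero_degZeroMap h f _)

end GroupAlgebra

/-! ### The coaction of the grading group -/

section Coaction

variable [Small.{u} Γ] (heven : evenPart lam = Set.univ) {s : Multiplier K Γ}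
  (hs : s ∈ NSMultipliers lam)

/-- The linear map sending a homogeneous element of degree `x` to the corresponding monomial of
degree `x`. -/
noncomputable def coactionLinear (A : GCAlg lam) : A.carrier →ₗ[K]
    (twistedGroupAlgebra (twistedFactor_eq_one heven hs) (Underlying heven hs A)).carrier :=
  (DirectSum.toModule K Γ _ (fun x => monomial (twistedFactor_eq_one heven hs) x ∘ₗ
    (toUnderlying heven hs A).toLinearMap ∘ₗ (A.deg x).subtype)) ∘ₗ
    (decomposeLinearEquiv A.deg).toLinearMap

theorem coactionLinear_of_mem {A : GCAlg lam} {x : Γ} {a : A.carrier} (ha : a ∈ A.deg x) :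
    coactionLinear heven hs A a =
      monomial (twistedFactor_eq_one heven hs) x (toUnderlying heven hs A a) := by
  lift a to A.deg x using ha
  simp only [coactionLinear, LinearMap.comp_apply, LinearEquiv.coe_coe,
    decomposeLinearEquiv_apply_coe, toModule_lof]
  simp

/-- The coaction of `Γ` on a graded algebra, as a morphism to the twisted group algebra with
coefficients in the underlying commutative algebra. -/
noncomputable def coaction (A : GCAlg lam) :
    A ⟶ twistedGroupAlgebra (twistedFactor_eq_one heven hs) (Underlying heven hs A) :=
  homOfLinear (coactionLinear heven hs A)
    (by rw [coactionLinear_of_mem heven hs A.one_mem_deg, toUnderlying_one, monomial_zero_one])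
    (fun x a ha => by
      rw [coactionLinear_of_mem heven hs ha]
      exact monomial_mem _ x _)
    -- The factor `s x y` from the commutative product cancels its inverse from the product of
    -- monomials.
    (fun x y a ha b hb => by
      rw [coactionLinear_of_mem heven hs ha, coactionLinear_of_mem heven hs hb,
        coactionLinear_of_mem heven hs (SetLike.mul_mem_graded ha hb), monomial_mul,
        toUnderlying_mul heven hs ha hb, map_smul (toUnderlying heven hs A),
        ← Units.smul_def, inv_smul_smul])

theorem algHom_coaction {A : GCAlg lam} {x : Γ} {a : A.carrier} (ha : a ∈ A.deg x) :
    algHom (coaction heven hs A) a =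
      monomial (twistedFactor_eq_one heven hs) x (toUnderlying heven hs A a) :=
  coactionLinear_of_mem heven hs ha

end Coaction

end GCAlg

/-! ### The graded determinant -/

namespace GCAlg

variable {K : Type u} [Field K] {Γ : Type v} [AddCommGroup Γ] [DecidableEq Γ]
  {lam : Γ → Γ → Kˣ}

/-- The change of multiplication is functorial. -/
noncomputable def twistMap (s : Multiplier K Γ) {A B : GCAlg lam} (f : A ⟶ B) :
    A.twist s ⟶ B.twist s :=
  homOfLinear ((B.toTwist s).toLinearMap ∘ₗ (algHom f).toLinearMap ∘ₗ
      (A.toTwist s).symm.toLinearMap)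
    (map_one (algHom f)) (fun _ _ ha => algHom_mem f ha)
    (fun x y a ha b hb => by
      change A.carrier at a b
      change algHom f (A.star s a b) = B.star s (algHom f a) (algHom f b)
      rw [A.star_of_mem s ha hb, B.star_of_mem s (algHom_mem f ha) (algHom_mem f hb), map_smul,
        map_mul])

variable (heven : evenPart lam = Set.univ) {s : Multiplier K Γ} (hs : s ∈ NSMultipliers lam)
  {n : ℕ} (nu : Fin n → Γ)

/-- The morphism of commutative algebras underlying a morphism. -/
noncomputable def underlyingMap {A B : GCAlg lam} (f : A ⟶ B) :
    Underlying heven hs A →ₐ[K] Underlying heven hs B :=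
  algHom (twistMap s f)

theorem underlyingMap_toUnderlying {A B : GCAlg lam} (f : A ⟶ B) (a : A.carrier) :
    underlyingMap heven hs f (toUnderlying heven hs A a) =
      toUnderlying heven hs B (algHom f a) := rfl

/-- The map `J_s` on matrices of degree `0`, as a multiplicative map. -/
noncomputable def matJHom (A : GCAlg lam) :
    A.mat0 nu →* Matrix (Fin n) (Fin n) (Underlying heven hs A) where
  toFun X := Matrix.of fun i j => ((s (nu i) (0 - nu i + nu j))⁻¹ : Kˣ) •
    toUnderlying heven hs A (X.1 i j)
  map_one' := by
    ext i j
    simp only [Matrix.of_apply, OneMemClass.coe_one, Matrix.one_apply]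
    split_ifs with hij
    · subst hij
      rw [show 0 - nu i + nu i = 0 by abel, s.zero_right, inv_one, one_smul, toUnderlying_one]
    · rw [map_zero, smul_zero]
  map_mul' X Y := by
    ext i k
    simp only [Matrix.of_apply, MulMemClass.coe_mul, Matrix.mul_apply]
    rw [map_sum, Finset.smul_sum]
    refine Finset.sum_congr rfl fun j _ => ?_
    have hadd : 0 - nu i + nu k = (0 - nu i + nu j) + (0 - nu j + nu k) := by abel
    -- The same cocycle identity as for monomial matrices, with all scalars inverted.
    have hc := s.cocycle (nu i) (0 - nu i + nu j) (0 - nu j + nu k)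
    rw [show nu i + (0 - nu i + nu j) = nu j by abel] at hc
    rw [smul_mul_smul_comm, toUnderlying_mul heven hs (X.2 i j) (Y.2 j k), map_smul,
      ← Units.smul_def, smul_smul, hadd, ← mul_inv, ← hc, mul_inv, inv_mul_cancel_right]

theorem matJHom_apply (A : GCAlg lam) (X : A.mat0 nu) (i j : Fin n) :
    matJHom heven hs nu A X i j =
      ((s (nu i) (0 - nu i + nu j))⁻¹ : Kˣ) • toUnderlying heven hs A (X.1 i j) := rfl

theorem detJ_eq (A : GCAlg lam) (X : A.mat0 nu) :
    A.detJ nu heven hs X = (matJHom heven hs nu A X).det := by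
  change Matrix.det (R := Underlying heven hs A) (A.matJ nu s 0 X) = _
  congr 1
  ext i j
  rw [matJHom_apply, matJ, Matrix.of_apply, s.zero_left, one_mul, map_smul]
  rfl

theorem matJHom_mat0Map {A B : GCAlg lam} (f : A ⟶ B) (X : A.mat0 nu) :
    matJHom heven hs nu B (mat0Map nu f X) =
      (underlyingMap heven hs f).mapMatrix (matJHom heven hs nu A X) := by
  ext i j
  rw [AlgHom.mapMatrix_apply, Matrix.map_apply, matJHom_apply, matJHom_apply, Units.smul_def,
    Units.smul_def, map_smul, underlyingMap_toUnderlying]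
  rfl

/-- In the Leibniz formula the degrees of the factors of each term add up to 0, a permutation only
rearranging the `nu i`; twisting does not change the grading. -/
theorem det_matJHom_mem (A : GCAlg lam) (X : A.mat0 nu) :
    (toUnderlying heven hs A).symm (matJHom heven hs nu A X).det ∈ A.deg 0 := by
  let deg : Γ → Submodule K (Underlying heven hs A) := (A.twist s).deg
  have : SetLike.GradedMonoid deg := (A.twist s).graded.toGradedMonoid
  change (matJHom heven hs nu A X).det ∈ deg 0
  rw [Matrix.det_apply]
  refine Submodule.sum_mem _ fun σ _ => ?_
  have h : ∏ i, matJHom heven hs nu A X (σ i) i ∈ deg (∑ i, (0 - nu (σ i) + nu i)) :=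
    SetLike.prod_mem_graded deg _ _ fun i _ => (deg _).smul_mem _ (X.2 (σ i) i)
  have h0 : ∑ i, (0 - nu (σ i) + nu i) = 0 := by
    simp only [zero_sub, Finset.sum_add_distrib, Finset.sum_neg_distrib]
    rw [Equiv.sum_comp σ nu, neg_add_cancel]
  rw [h0] at h
  rw [Units.smul_def]
  exact zsmul_mem h _

/-- The determinant `det (J_s X)`, as a multiplicative map with values in degree `0`. -/
noncomputable def gdetHom (A : GCAlg lam) : A.mat0 nu →* A.deg 0 where
  toFun X := ⟨(toUnderlying heven hs A).symm (matJHom heven hs nu A X).det,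
    det_matJHom_mem heven hs nu A X⟩
  map_one' := Subtype.ext <| (LinearEquiv.symm_apply_eq _).2 <| by
    rw [map_one, Matrix.det_one]
    rfl
  map_mul' X Y := Subtype.ext <| (LinearEquiv.symm_apply_eq _).2 <| by
    have h := toUnderlying_mul heven hs (det_matJHom_mem heven hs nu A X)
      (det_matJHom_mem heven hs nu A Y)
    rw [s.map_zero, Units.val_one, one_smul, LinearEquiv.apply_symm_apply,
      LinearEquiv.apply_symm_apply] at h
    rw [map_mul, Matrix.det_mul, h]
    rfl

theorem toUnderlying_gdetHom (A : GCAlg lam) (X : A.mat0 nu) :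
    toUnderlying heven hs A (gdetHom heven hs nu A X) = (matJHom heven hs nu A X).det :=
  LinearEquiv.apply_symm_apply _ _

/-- The graded determinant attached to an NS-multiplier. -/
noncomputable def gdet : GL0 (lam := lam) nu ⟶ unitsDegZero where
  app A := GrpCat.ofHom (Units.map (gdetHom heven hs nu A))
  naturality A B f := by
    ext X
    refine Units.ext (Subtype.ext ((toUnderlying heven hs B).injective ?_))
    refine (toUnderlying_gdetHom heven hs nu B (mat0Map nu f X.1)).trans ?_
    rw [matJHom_mat0Map, ← AlgHom.map_det, ← toUnderlying_gdetHom]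
    exact underlyingMap_toUnderlying heven hs f _

/-- Diagonal entries have degree 0 and `s x 0 = 1`, so `J_s` leaves them unscaled. Since `1 ≤ n`,
the last index is a genuine `n - 1`. -/
theorem isNormalized_gdet (hn : 1 ≤ n) : IsNormalized nu (gdet heven hs nu) := by
  intro A a
  refine Units.ext (Subtype.ext ((toUnderlying heven hs A).injective ?_))
  refine (toUnderlying_gdetHom heven hs nu A (A.lastDiag nu a.1)).trans ?_
  have h : matJHom heven hs nu A (A.lastDiag nu a.1) = Matrix.diagonal fun i : Fin n =>
      if i = ⟨n - 1, by omega⟩ then toUnderlying heven hs A a.1 else 1 := by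
    ext i j
    rw [matJHom_apply, lastDiag]
    simp only [MonoidHom.coe_mk, OneHom.coe_mk, Matrix.diagonal_apply, Fin.ext_iff]
    by_cases hij : (i : ℕ) = j
    · obtain rfl := Fin.ext hij
      simp only [if_true]
      rw [show 0 - nu i + nu i = 0 by abel, s.zero_right, inv_one, one_smul]
      have : (i : ℕ) + 1 = n ↔ (i : ℕ) = n - 1 := by omega
      simp only [this]
      split_ifs <;> rfl
    · rw [if_neg hij, if_neg hij, map_zero, smul_zero]
  rw [h, Matrix.det_diagonal, Finset.prod_ite_eq' _ _ fun _ => _, if_pos (Finset.mem_univ _)]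

/-! ### Classification and uniqueness -/

section Comparison

variable [Small.{u} Γ]

/-- The scalars of `monomialMatrix` and of `J_s` are inverse to each other. This identity reduces
arbitrary degree-0 matrices to matrices over a commutative algebra. -/
theorem mat0Map_coaction (A : GCAlg lam) (X : A.mat0 nu) :
    mat0Map nu (coaction heven hs A) X =
      monomialMatrix (twistedFactor_eq_one heven hs) nu _ (matJHom heven hs nu A X) :=
  Subtype.ext <| by
    ext i j
    refine (algHom_coaction heven hs (X.2 i j)).trans ?_
    simp only [monomialMatrix, MonoidHom.coe_mk, OneHom.coe_mk, Matrix.of_apply, matJHom_apply,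
      smul_inv_smul]

/-- A natural transformation is determined by the homomorphisms it induces over commutative
algebras. -/
theorem toUnderlying_component (E : GL0 (lam := lam) nu ⟶ unitsDegZero) (A : GCAlg lam)
    (X : (A.mat0 nu)ˣ) :
    toUnderlying heven hs A ((component nu E A X : A.deg 0) : A.carrier) =
      componentOnCommutative (twistedFactor_eq_one heven hs) nu E (Underlying heven hs A)
        (Units.map (matJHom heven hs nu A) X) := by
  have hX : Units.map (monomialMatrix (twistedFactor_eq_one heven hs) nu _)
      (Units.map (matJHom heven hs nu A) X) =
      Units.map (mat0Map nu (coaction heven hs A) : _ →* _) X :=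
    Units.ext (mat0Map_coaction heven hs nu A X.1).symm
  simp only [componentOnCommutative, MonoidHom.comp_apply]
  rw [hX, component_naturality]
  change _ = coeff (twistedFactor_eq_one heven hs) 0
    (algHom (coaction heven hs A) ((component nu E A X : A.deg 0) : A.carrier))
  rw [algHom_coaction heven hs (component nu E A X : A.deg 0).2, coeff_monomial]

/-- The exponent is uniform in `A` because it comes from the single natural family induced on all
commutative algebras. -/
theorem exists_eq_gdet_zpow [CharZero K] (hn : 1 ≤ n)
    (E : GL0 (lam := lam) nu ⟶ unitsDegZero) : ∃ t : ℤ, ∀ (A : GCAlg lam) (X : (A.mat0 nu)ˣ),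
      component nu E A X = component nu (gdet heven hs nu) A X ^ t := by
  have : Nonempty (Fin n) := ⟨⟨0, hn⟩⟩
  have h := twistedFactor_eq_one heven hs
  obtain ⟨t, ht⟩ := exists_eq_detUnits_zpow_of_natural two_ne_zero
    (fun S _ _ => componentOnCommutative h nu E S)
    (fun S S' _ _ _ _ f U => componentOnCommutative_naturality h nu E f U)
  -- On degree 0 the two products agree, as `s 0 0 = 1`; the comparison can thus be made in the
  -- commutative algebra.
  let j (A : GCAlg lam) : A.deg 0 →* Underlying heven hs A :=
    { toFun := fun a => toUnderlying heven hs A a.1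
      map_one' := rfl
      map_mul' := fun a b => by
        rw [toUnderlying_mul heven hs a.2 b.2, s.map_zero, Units.val_one, one_smul]
        rfl }
  have hj (A : GCAlg lam) : Function.Injective (j A) := fun a b hab =>
    Subtype.ext ((toUnderlying heven hs A).injective hab)
  refine ⟨t, fun A X => Units.map_injective (hj A) ?_⟩
  rw [map_zpow]
  have h1 : Units.map (j A) (component nu (gdet heven hs nu) A X) =
      detUnits _ _ (Units.map (matJHom heven hs nu A) X) :=
    Units.ext (toUnderlying_gdetHom heven hs nu A X.1)
  have h2 : Units.map (j A) (component nu E A X) = componentOnCommutative h nu E _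
      (Units.map (matJHom heven hs nu A) X) :=
    Units.ext (toUnderlying_component heven hs nu E A X)
  rw [h1, h2, ht]

theorem eq_gdet_of_isNormalized [CharZero K] (hn : 1 ≤ n)
    {D : GL0 (lam := lam) nu ⟶ unitsDegZero} (hD : IsNormalized nu D) :
    D = gdet heven hs nu := by
  obtain ⟨t, ht⟩ := exists_eq_gdet_zpow heven hs nu hn D
  have h := twistedFactor_eq_one heven hs
  -- Over coefficients `K`, reading off the degree-0 coefficient turns the normalization at the
  -- scalar 2 into `2 = 2 ^ t` in `K`.
  let A : GCAlg lam := twistedGroupAlgebra h K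
  let ι : K →* A.deg 0 :=
    { toFun := fun c => ⟨monomial h 0 c, monomial_mem h 0 c⟩
      map_one' := Subtype.ext (monomial_zero_one h)
      map_mul' := fun a b => Subtype.ext <| by
        refine Eq.trans ?_ (monomial_mul h 0 0 a b).symm
        rw [s.map_zero, inv_one, one_smul, add_zero] }
  let two : Kˣ := Units.mk0 2 two_ne_zero
  have h2 : two = two ^ t := by
    have h1 := ht A (Units.map (A.lastDiag nu) (Units.map ι two))
    rw [hD, isNormalized_gdet heven hs nu hn] at h1
    have h3 := congrArg (Units.map (coeffZero h K)) h1
    have h4 : Units.map (coeffZero h K) (Units.map ι two) = two :=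
      Units.ext (coeff_monomial h 0 _)
    rwa [map_zpow, h4] at h3
  have ht1 : t = 1 := by
    -- Characteristic zero brings the equation down to `ℚ`, where powers of 2 are distinct.
    have h3 : (2 : ℚ) ^ (1 : ℤ) = 2 ^ t := by
      have := congrArg Units.val h2
      rw [Units.val_zpow_eq_zpow_val, Units.val_mk0] at this
      have hcast : (((2 : ℚ) ^ (1 : ℤ) : ℚ) : K) = (((2 : ℚ) ^ t : ℚ) : K) := by
        push_cast
        exact this
      exact_mod_cast hcast
    exact (zpow_right_injective₀ (by norm_num) (by norm_num) h3).symm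
  subst ht1
  ext A X
  exact (ht A X).trans (zpow_one _)

end Comparison

end GCAlg

/-! ### The main theorem -/

theorem theoremC {K : Type u} [Field K] [CharZero K] {Γ : Type v} [AddCommGroup Γ]
    [AddGroup.FG Γ] [DecidableEq Γ] (lam : Γ → Γ → Kˣ) (hlam : IsCommutationFactor lam)
    (heven : evenPart lam = Set.univ) (n : ℕ) (hn : 1 ≤ n) (nu : Fin n → Γ) :
    (∃! D : GCAlg.GL0 (lam := lam) nu ⟶ GCAlg.unitsDegZero, GCAlg.IsNormalized nu D) ∧
    ∀ D : GCAlg.GL0 (lam := lam) nu ⟶ GCAlg.unitsDegZero, GCAlg.IsNormalized nu D →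
      (∀ (s : Multiplier K Γ) (hs : s ∈ NSMultipliers lam) (A : GCAlg lam) (X : (A.mat0 nu)ˣ),
        A.toTwist s ((GCAlg.component nu D A X : A.deg 0) : A.carrier) =
          GCAlg.detJ nu heven hs A X) ∧
      (∀ E : GCAlg.GL0 (lam := lam) nu ⟶ GCAlg.unitsDegZero, ∃ t : ℤ,
        ∀ (A : GCAlg lam) (X : (A.mat0 nu)ˣ), GCAlg.component nu E A X = GCAlg.component nu D A X ^ t) := by
  -- A finitely generated abelian group is countable, so it has a copy in the universe of the
  -- algebras, as the group algebras require.
  have : Module.Finite ℤ Γ := Module.Finite.iff_addGroup_fg.2 inferInstance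
  obtain ⟨k, f, hf⟩ := Module.Finite.exists_fin' ℤ Γ
  have : Countable Γ := hf.countable
  have : Small.{u} Γ := inferInstance
  obtain ⟨s₀, hs₀⟩ := NSMultipliers_nonempty hlam heven
  refine ⟨⟨GCAlg.gdet heven hs₀ nu, GCAlg.isNormalized_gdet heven hs₀ nu hn,
    fun D hD => GCAlg.eq_gdet_of_isNormalized heven hs₀ nu hn hD⟩, fun D hD => ⟨?_, ?_⟩⟩
  · intro s hs A X
    -- Uniqueness holds with any NS-multiplier, so `D` equals the determinant built from this
    -- particular `s`.
    rw [GCAlg.eq_gdet_of_isNormalized heven hs nu hn hD, GCAlg.detJ_eq]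
    exact GCAlg.toUnderlying_gdetHom heven hs nu A X.1
  · rw [GCAlg.eq_gdet_of_isNormalized heven hs₀ nu hn hD]
    exact GCAlg.exists_eq_gdet_zpow heven hs₀ nu hn
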